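/- Let $E$ and $F$ be complex Banach spaces and let $U\subseteq E$ be open. For $1\le p\le\infty$ let $p^*$ denote the conjugate index of $p$, given by $1/p+1/p^*=1$. A holomorphic mapping $f\colon U\to F$ is called \emph{Cohen strongly $p$-summing} if there is a constant $C\ge 0$ such that for all $n\in\mathbb{N}$, $\lambda_1,\dots,\lambda_n\in\mathbb{C}$, $x_1,\dots,x_n\in U$ and $y_1^*,\dots,y_n^*\in F^*$, $$\sum_{i=1}^n|\lambda_i|\,|\langle y_i^*,f(x_i)\rangle|\le C\Big(\sum_{i=1}^n|\lambda_i|^p\Big)^{1/p}\ \sup_{y^{**}\in B_{F^{**}}}\Big(\sum_{i=1}^n|y^{**}(y_i^*)|^{p^*}\Big)^{1/p^*},$$ where $B_{F^{**}}$ is the closed unit ball of $F^{**}$, and where $(\sum_i|a_i|^{q})^{1/q}$ is read as $\max_i|a_i|$ if $q=\infty$. Let $\mathcal{D}_p^{\mathcal{H}^\infty}(U,F)$ be the set of all such mappings $f$, and let $d_p^{\mathcal{H}^\infty}(f)$ be the infimum of all such constants $C$. Let $1<p_1\le p_2\le\infty$. Then $\mathcal{D}_{p_2}^{\mathcal{H}^\infty}(U,F)\subseteq\mathcal{D}_{p_1}^{\mathcal{H}^\infty}(U,F)$,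 and $d_{p_1}^{\mathcal{H}^\infty}(f)\le d_{p_2}^{\mathcal{H}^\infty}(f)$ for every $f\in\mathcal{D}_{p_2}^{\mathcal{H}^\infty}(U,F)$. -/

import Mathlib

open scoped ENNReal

noncomputable section

/-- The `ℓ_p`-norm `(∑ |a_i| ^ p) ^ (1 / p)` of a finite family of scalars, read as
`max |a_i|` if `p = ∞`. -/
def finLpNorm (p : ℝ≥0∞) {n : ℕ} (a : Fin n → ℂ) : ℝ :=
  ‖(WithLp.toLp p a : PiLp p (fun _ : Fin n => ℂ))‖

/-- The weak `ℓ_q`-norm of a finite family of functionals `y_1, …, y_n` on `F`: the supremum, over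
the closed unit ball of the bidual of `F`, of the `ℓ_q`-norm of `(φ y_1, …, φ y_n)`. -/
def finWeakLpNorm {F : Type*} [NormedAddCommGroup F] [NormedSpace ℂ F]
    (q : ℝ≥0∞) {n : ℕ} (y : Fin n → StrongDual ℂ F) : ℝ :=
  ⨆ φ : {φ : StrongDual ℂ (StrongDual ℂ F) // ‖φ‖ ≤ 1},
    finLpNorm q (fun i => φ.1 (y i))

/-- `C ≥ 0` is a Cohen constant of index `p` for `f` on `U`. Here `ENNReal.conjExponent p` is the
conjugate index of `p`, equal to `∞`, `p / (p - 1)`, `1` for `p = 1`, `1 < p < ∞`, `p = ∞`. -/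
def IsCohenConstant {E F : Type*} [NormedAddCommGroup F] [NormedSpace ℂ F]
    (p : ℝ≥0∞) (U : Set E) (f : E → F) (C : ℝ) : Prop :=
  0 ≤ C ∧ ∀ (n : ℕ) (lam : Fin n → ℂ) (x : Fin n → E) (y : Fin n → StrongDual ℂ F),
    (∀ i, x i ∈ U) →
      ∑ i, ‖lam i‖ * ‖y i (f (x i))‖
        ≤ C * finLpNorm p lam * finWeakLpNorm (ENNReal.conjExponent p) y

/-- The set of Cohen strongly `p`-summing holomorphic mappings from the open set `U` to `F`.
A mapping on `U` is represented by a function on `E`, of which only the values on `U` matter;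
on an open set, holomorphic means complex Fréchet differentiable at every point. -/
def cohenSummingHol {E : Type*} [NormedAddCommGroup E] [NormedSpace ℂ E]
    (F : Type*) [NormedAddCommGroup F] [NormedSpace ℂ F]
    (p : ℝ≥0∞) (U : Set E) : Set (E → F) :=
  {f | DifferentiableOn ℂ f U ∧ ∃ C : ℝ, IsCohenConstant p U f C}

/-- The Cohen strongly `p`-summing norm of `f`: the infimum of its Cohen constants. -/
def cohenNorm {E F : Type*} [NormedAddCommGroup F] [NormedSpace ℂ F]
    (p : ℝ≥0∞) (U : Set E) (f : E → F) : ℝ :=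
  sInf {C : ℝ | IsCohenConstant p U f C}

end

/-! Every Cohen constant for `p₂` is one for `p₁`, which gives both claims. For `p₁ < p₂` put `1/r =
1/p₁ - 1/p₂ = 1/p₂* - 1/p₁*` and split `|λ_i| = |λ_i|^(p₁/p₂) * |λ_i|^(p₁/r)`. The first factor
stays as scalar and the second moves onto `y_i`. Hölder (`finWeakLpNorm_smul_le`) bounds the new
weak `p₂*`-norm, and by `finLpNorm_rpow_le` the two scalar norms multiply to at most `‖λ‖_{p₁}`. -/

theorem finLpNorm_nonneg {p : ℝ≥0∞} (hp : p ≠ 0) {n : ℕ} (a : Fin n → ℂ) :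
    0 ≤ finLpNorm p a := by
  unfold finLpNorm
  rcases eq_or_ne p ∞ with rfl | h
  · rw [PiLp.norm_eq_ciSup]
    exact Real.iSup_nonneg fun i => norm_nonneg _
  · rw [PiLp.norm_eq_sum (ENNReal.toReal_pos hp h)]
    positivity

theorem finLpNorm_eq_sum {p : ℝ≥0∞} (hp : 0 < p.toReal) {n : ℕ} (a : Fin n → ℂ) :
    finLpNorm p a = (∑ i, ‖a i‖ ^ p.toReal) ^ (1 / p.toReal) := by
  unfold finLpNorm
  rw [PiLp.norm_eq_sum hp]

theorem finLpNorm_mono {p : ℝ≥0∞} (hp : 0 < p.toReal) {n : ℕ} {a b : Fin n → ℂ}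
    (h : ∀ i, ‖a i‖ ≤ ‖b i‖) : finLpNorm p a ≤ finLpNorm p b := by
  rw [finLpNorm_eq_sum hp, finLpNorm_eq_sum hp]
  gcongr with i
  exact h i

/-- Hölder's inequality for the finite `ℓ_p`-norms. -/
theorem finLpNorm_mul_le {p q r : ℝ≥0∞}
    (h : Real.HolderTriple p.toReal q.toReal r.toReal) {n : ℕ} (a b : Fin n → ℂ) :
    finLpNorm r (fun i => a i * b i) ≤ finLpNorm p a * finLpNorm q b := by
  rw [finLpNorm_eq_sum h.pos, finLpNorm_eq_sum h.symm.pos, finLpNorm_eq_sum h.pos']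
  have hr := h.pos'
  have key := Real.Lr_rpow_le_Lp_mul_Lq_of_nonneg Finset.univ h
    (f := fun i => ‖a i‖) (g := fun i => ‖b i‖) (fun i _ => norm_nonneg _)
    (fun i _ => norm_nonneg _)
  simp only [norm_mul]
  refine (Real.rpow_le_rpow (by positivity) key (by positivity)).trans_eq ?_
  rw [Real.mul_rpow (by positivity) (by positivity), ← Real.rpow_mul (by positivity),
    ← Real.rpow_mul (by positivity)]
  congr 2 <;> field_simp

/-- The `ℓ_q`-norm of the family of powers `|a_i| ^ (p / q)`, where `p / q = 0` if `q = ∞`. -/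
theorem finLpNorm_rpow_le {p q : ℝ≥0∞} (hp : 0 < p.toReal) (hq : q ≠ 0) {n : ℕ}
    (a : Fin n → ℂ) :
    finLpNorm q (fun i => ((‖a i‖ ^ (p.toReal * q.toReal⁻¹) : ℝ) : ℂ))
      ≤ finLpNorm p a ^ (p.toReal * q.toReal⁻¹) := by
  rcases eq_or_ne q ∞ with rfl | h
  · unfold finLpNorm
    rw [PiLp.norm_eq_ciSup]
    -- Since `∞.toReal⁻¹ = 0`, every entry and the bound equal `1`; for `n = 0` the left side is
    -- `0`, hence only `≤`.
    refine Real.iSup_le (fun i => ?_) (by simp)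
    simp
  · have hq' := ENNReal.toReal_pos hq h
    rw [finLpNorm_eq_sum hq', finLpNorm_eq_sum hp, ← Real.rpow_mul (by positivity)]
    have e : 1 / p.toReal * (p.toReal * q.toReal⁻¹) = 1 / q.toReal := by field_simp
    rw [e]
    refine le_of_eq ?_
    congr 1
    refine Finset.sum_congr rfl fun i _ => ?_
    rw [Complex.norm_real, Real.norm_of_nonneg (by positivity), ← Real.rpow_mul (norm_nonneg _)]
    congr 1
    field_simp

section WeakNorm

variable {F : Type*} [NormedAddCommGroup F] [NormedSpace ℂ F]

theorem finLpNorm_apply_le_finWeakLpNorm {q : ℝ≥0∞} (hq : 0 < q.toReal) {n : ℕ}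
    (y : Fin n → StrongDual ℂ F) {φ : StrongDual ℂ (StrongDual ℂ F)} (hφ : ‖φ‖ ≤ 1) :
    finLpNorm q (fun i => φ (y i)) ≤ finWeakLpNorm q y := by
  -- A real supremum needs an upper bound: `|ψ(y_i)| ≤ ‖y_i‖` on the unit ball supplies one.
  refine le_ciSup (f := fun φ : {φ : StrongDual ℂ (StrongDual ℂ F) // ‖φ‖ ≤ 1} =>
    finLpNorm q (fun i => φ.1 (y i))) ⟨finLpNorm q (fun i => ((‖y i‖ : ℝ) : ℂ)), ?_⟩ ⟨φ, hφ⟩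
  rintro _ ⟨ψ, rfl⟩
  refine finLpNorm_mono hq fun i => ?_
  rw [Complex.norm_real, norm_norm]
  exact ψ.1.le_of_opNorm_le ψ.2 (y i) |>.trans_eq (one_mul _)

theorem finWeakLpNorm_nonneg {q : ℝ≥0∞} (hq : q ≠ 0) {n : ℕ} (y : Fin n → StrongDual ℂ F) :
    0 ≤ finWeakLpNorm q y :=
  Real.iSup_nonneg fun _ => finLpNorm_nonneg hq _

/-- Hölder for each fixed `φ`, then the supremum over `φ`. -/
theorem finWeakLpNorm_smul_le {p q r : ℝ≥0∞}
    (h : Real.HolderTriple p.toReal q.toReal r.toReal) {n : ℕ} (a : Fin n → ℂ)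
    (y : Fin n → StrongDual ℂ F) :
    finWeakLpNorm r (fun i => a i • y i) ≤ finLpNorm p a * finWeakLpNorm q y := by
  have hp : p ≠ 0 := (ENNReal.toReal_pos_iff.1 h.pos).1.ne'
  have hq : q ≠ 0 := (ENNReal.toReal_pos_iff.1 h.symm.pos).1.ne'
  refine Real.iSup_le (fun φ => ?_)
    (mul_nonneg (finLpNorm_nonneg hp a) (finWeakLpNorm_nonneg hq y))
  simp only [map_smul, smul_eq_mul]
  exact (finLpNorm_mul_le h a _).trans <| mul_le_mul_of_nonneg_left
    (finLpNorm_apply_le_finWeakLpNorm h.symm.pos y φ.2) (finLpNorm_nonneg hp a)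

end WeakNorm

theorem ENNReal.inv_toReal_conjExponent {p : ℝ≥0∞} (hp : 1 < p) :
    (ENNReal.conjExponent p).toReal⁻¹ = 1 - p.toReal⁻¹ := by
  have h := (ENNReal.HolderConjugate.conjExponent hp.le).inv_add_inv_eq_one
  have h' := congrArg ENNReal.toReal h
  rw [ENNReal.toReal_add, ENNReal.toReal_inv, ENNReal.toReal_inv, ENNReal.toReal_one] at h'
  · linarith
  · exact ENNReal.inv_ne_top.2 (zero_lt_one.trans hp).ne'
  · refine ne_top_of_le_ne_top ENNReal.one_ne_top (h ▸ le_add_self)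

theorem IsCohenConstant.anti_exponent {E F : Type*} [NormedAddCommGroup F] [NormedSpace ℂ F]
    {p₁ p₂ : ℝ≥0∞} (hp₁ : 1 < p₁) (hp : p₁ ≤ p₂) {U : Set E} {f : E → F} {C : ℝ}
    (h : IsCohenConstant p₂ U f C) : IsCohenConstant p₁ U f C := by
  -- For equal indices `r` would be infinite, which the real Hölder triple excludes.
  rcases hp.eq_or_lt with rfl | hlt
  · exact h
  obtain ⟨hC, h⟩ := h
  refine ⟨hC, fun n lam x y hx => ?_⟩
  have htop : p₁ ≠ ∞ := hlt.ne_top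
  have hP : 1 < p₁.toReal := by
    simpa using (ENNReal.toReal_lt_toReal ENNReal.one_ne_top htop).2 hp₁
  have hP0 : 0 < p₁.toReal := zero_lt_one.trans hP
  have hS0 : 0 ≤ p₂.toReal⁻¹ := by positivity
  have hS : p₂.toReal⁻¹ < p₁.toReal⁻¹ := by
    rcases eq_or_ne p₂ ∞ with rfl | h2
    · simpa using hP0
    · exact inv_strictAnti₀ hP0 ((ENNReal.toReal_lt_toReal htop h2).2 hlt)
  have hP1 : p₁.toReal⁻¹ < 1 := inv_lt_one_of_one_lt₀ hP
  have hp₂ : p₂ ≠ 0 := (zero_lt_one.trans (hp₁.trans hlt)).ne'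
  have hq₁ := ENNReal.inv_toReal_conjExponent hp₁
  have hq₂ := ENNReal.inv_toReal_conjExponent (hp₁.trans hlt)
  set r : ℝ≥0∞ := ENNReal.ofReal (p₁.toReal⁻¹ - p₂.toReal⁻¹)⁻¹ with hr
  have hr_inv : r.toReal⁻¹ = p₁.toReal⁻¹ - p₂.toReal⁻¹ := by
    rw [hr, ENNReal.toReal_ofReal (inv_nonneg.2 (sub_nonneg.2 hS.le)), inv_inv]
  have triple : Real.HolderTriple r.toReal (ENNReal.conjExponent p₁).toReal
      (ENNReal.conjExponent p₂).toReal :=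
    ⟨by rw [hr_inv, hq₁, hq₂]; ring, inv_pos.1 (by rw [hr_inv]; linarith),
      inv_pos.1 (by rw [hq₁]; linarith)⟩
  have hr0 : r ≠ 0 := (ENNReal.toReal_pos_iff.1 triple.pos).1.ne'
  have hsum : p₁.toReal * p₂.toReal⁻¹ + p₁.toReal * r.toReal⁻¹ = 1 := by
    rw [hr_inv, mul_sub, mul_inv_cancel₀ hP0.ne']; ring
  -- If `p₂ = ∞` the exponent is `0`, so `a` is constantly `1`, even where `lam` vanishes.
  set a : Fin n → ℂ := fun i => ((‖lam i‖ ^ (p₁.toReal * p₂.toReal⁻¹) : ℝ) : ℂ) with ha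
  set b : Fin n → ℂ := fun i => ((‖lam i‖ ^ (p₁.toReal * r.toReal⁻¹) : ℝ) : ℂ) with hb
  have hab : ∀ i, ‖a i‖ * ‖b i‖ = ‖lam i‖ := fun i => by
    simp only [ha, hb, Complex.norm_real]
    rw [Real.norm_of_nonneg (by positivity), Real.norm_of_nonneg (by positivity),
      ← Real.rpow_add_of_nonneg (norm_nonneg _) (by positivity) (by positivity), hsum,
      Real.rpow_one]
  have hL : 0 ≤ finLpNorm p₁ lam := finLpNorm_nonneg (zero_lt_one.trans hp₁).ne' lam
  have hW : 0 ≤ finWeakLpNorm (ENNReal.conjExponent p₁) y :=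
    finWeakLpNorm_nonneg (ENNReal.toReal_pos_iff.1 triple.symm.pos).1.ne' y
  calc ∑ i, ‖lam i‖ * ‖y i (f (x i))‖
      = ∑ i, ‖a i‖ * ‖(b i • y i) (f (x i))‖ := by
        refine Finset.sum_congr rfl fun i _ => ?_
        rw [smul_apply, norm_smul, ← mul_assoc, hab]
    _ ≤ C * finLpNorm p₂ a * finWeakLpNorm (ENNReal.conjExponent p₂) (fun i => b i • y i) :=
        h n a x _ hx
    _ ≤ C * finLpNorm p₂ a * (finLpNorm r b * finWeakLpNorm (ENNReal.conjExponent p₁) y) :=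
        mul_le_mul_of_nonneg_left (finWeakLpNorm_smul_le triple b y)
          (mul_nonneg hC (finLpNorm_nonneg hp₂ a))
    _ = C * (finLpNorm p₂ a * finLpNorm r b) * finWeakLpNorm (ENNReal.conjExponent p₁) y := by
        ring
    _ ≤ C * finLpNorm p₁ lam * finWeakLpNorm (ENNReal.conjExponent p₁) y := by
        gcongr
        calc finLpNorm p₂ a * finLpNorm r b
            ≤ finLpNorm p₁ lam ^ (p₁.toReal * p₂.toReal⁻¹)
                * finLpNorm p₁ lam ^ (p₁.toReal * r.toReal⁻¹) :=
              mul_le_mul (finLpNorm_rpow_le hP0 hp₂ lam) (finLpNorm_rpow_le hP0 hr0 lam)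
                (finLpNorm_nonneg hr0 b) (by positivity)
          _ = finLpNorm p₁ lam := by
              rw [← Real.rpow_add_of_nonneg hL (by positivity) (by positivity), hsum,
                Real.rpow_one]

theorem mainTheorem12 {E F : Type*}
    [NormedAddCommGroup E] [NormedSpace ℂ E] [CompleteSpace E]
    [NormedAddCommGroup F] [NormedSpace ℂ F] [CompleteSpace F]
    (U : Set E) (hU : IsOpen U) (p₁ p₂ : ℝ≥0∞) (hp₁ : 1 < p₁) (hp : p₁ ≤ p₂) :
    cohenSummingHol F p₂ U ⊆ cohenSummingHol F p₁ U ∧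
      ∀ f ∈ cohenSummingHol F p₂ U, cohenNorm p₁ U f ≤ cohenNorm p₂ U f := by
  refine ⟨fun f ⟨hf, C, hC⟩ => ⟨hf, C, hC.anti_exponent hp₁ hp⟩, fun f ⟨_, hC⟩ => ?_⟩
  exact csInf_le_csInf ⟨0, fun C h => h.1⟩ hC fun C h => h.anti_exponent hp₁ hp
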